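/- A \emph{doctrine} on a category $\mathbb C$ with finite products (terminal object $\mathbf t$) is a functor $P:\mathbb C^{\mathrm{op}}\to\mathbf{Pos}$; $P(A)$ is the fiber over $A$ and $P(f)$ the reindexing along $f$. It is \emph{consistent} if there are $a,b\in P(\mathbf t)$ with $a\nleq b$. It is \emph{implicational} if each fiber is a cartesian closed poset (finite meets $\land,\top$ and implication $\to$) and reindexing preserves $\land,\top,\to$; \emph{bounded} if each fiber has a top and a bottom element, preserved by reindexing; \emph{existential} if, for all $C,B$, the map $P(\mathrm{pr}_1):P(C)\to P(C\times B)$ has a left adjoint $\exists^B_C$ with $\exists^B_C P(f\times \mathrm{id}_B)=P(f)\exists^B_{C'}$ for $f:C\to C'$ (Beck--Chevalley) and $\exists^B_C(\alpha\land P(\mathrm{pr}_1)\beta)=\exists^B_C(\alpha)\land\beta$ (Frobenius). Let $P:\mathbb C^{\mathrm{op}}\to\mathbf{Pos}$ be a bounded existential implicational doctrine with small base category. Its Henkin extension $\underrightarrow P$ is constructed as follows. \emph{Constants.} Let $\Lambda=\mathrm{card}\big(\bigsqcup_{X}P(X)\big)$, regarded as an initial ordinal. Let $J$ be the set of finite lists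 $\bar X=((X_1,x_1),\dots,(X_n,x_n))$ of distinct pairs with $X_a\in\mathrm{ob}\,\mathbb C$, $x_a\in\Lambda$, preordered by inclusion of the sets of entries; for $\bar X\le\bar Y$ there is an induced projection $\prod Y_b\to\prod X_a$. The category $\underline{\mathbb C}$ has the objects of $\mathbb C$; its arrows $A\to B$ are the elements of the directed colimit over $\bar X\in J$ of $\mathrm{Hom}_{\mathbb C}(\prod X_a\times A,B)$, composed by $[g,\bar X]\circ[f,\bar X]=[g\langle \mathrm{pr}_1,f\rangle,\bar X]$. The doctrine $\underline P$ on $\underline{\mathbb C}$ has as fiber $\underline P(A)$ the directed colimit over $\bar X\in J$ of the posets $P(\prod X_a\times A)$, with reindexing $\underline P([f,\bar X])[\psi,\bar X]=[P(\langle\mathrm{pr}_1,f\rangle)\psi,\bar X]$. \emph{Choices.} For every object $B$, choose a listing $[\varphi^B_j,\bar X^{(B,j)}]$, $j\in\Lambda$, of all the elements of $\underline P(B)$ (repetitions allowed) with representatives $\varphi^B_j\in P(\prod X^{(B,j)}_a\times B)$, in such a way that for every $j\in\Lambda$ the following ordinal $d^B_j$ belongs to $\Lambda$: $d^B_j$ is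 the smallest ordinal that is greater than $d^B_h$ for all $h<j$ and greater than all the labels $x^{(B,k)}_a$ occurring in $\bar X^{(B,k)}$, for all $k\le j$. \emph{Axioms.} Let $\psi^B_j=P(\mathrm{pr}_1)\exists^B_{\prod X_a}\varphi^B_j\to\varphi^B_j$ in $P(\prod X^{(B,j)}_a\times B)$, let $\bar X^{(B,j)}_\star$ be $\bar X^{(B,j)}$ with $(B,d^B_j)$ added at the end, and consider the Henkin axiom $[\psi^B_j,\bar X^{(B,j)}_\star]\in\underline P(\mathbf t)$. For a finite set $\mathcal U$ of pairs $(B,j)$, let $\underline P^{\,\mathcal U}(A)$ be the poset of the elements of $\underline P(A)$ below $\underline P(!_A)\bigwedge_{(B,j)\in\mathcal U}[\psi^B_j,\bar X^{(B,j)}_\star]$. The doctrine $\underrightarrow P$ on $\underline{\mathbb C}$ has as fiber over $A$ the directed colimit of the posets $\underline P^{\,\mathcal U}(A)$ over all finite $\mathcal U$ ordered by inclusion, with transition maps $\alpha\mapsto\alpha\land\underline P(!_A)\bigwedge_{(B,j)\in\mathcal V}[\psi^B_j,\bar X^{(B,j)}_\star]$ for $\mathcal U\subseteq\mathcal V$,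 and reindexing induced by that of $\underline P$. \textbf{Proposition.} Let $P:\mathbb C^{\mathrm{op}}\to\mathbf{Pos}$ be a bounded existential implicational doctrine such that each fiber is non-trivial (not a singleton) and $\mathbb C$ is small. Then choices as above exist, and for every such choice the doctrine $\underrightarrow P$ is consistent. -/

import Mathlib

open CategoryTheory MonoidalCategory CartesianMonoidalCategory Opposite

universe u v w t

noncomputable section

/-! ### Doctrines -/

/-- A doctrine on a category with (chosen) finite products: a contravariant functor to posets. -/
abbrev Doctrine (C : Type u) [Category.{v} C] [CartesianMonoidalCategory C] :
    Type (max u v (w + 1)) :=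
  Cᵒᵖ ⥤ PartOrd.{w}

namespace Doctrine

variable {C : Type u} [Category.{v} C] [CartesianMonoidalCategory C]

/-- The fiber `P(A)`. -/
abbrev Fiber (P : Doctrine.{u, v, w} C) (A : C) : Type w := P.obj (op A)

/-- The reindexing `P(f) : P(B) → P(A)` along `f : A ⟶ B`. -/
def reindex (P : Doctrine.{u, v, w} C) {A B : C} (f : A ⟶ B) : P.Fiber B →o P.Fiber A :=
  (P.map f.op).hom

theorem reindex_id (P : Doctrine.{u, v, w} C) {A : C} (x : P.Fiber A) :
    P.reindex (𝟙 A) x = x := by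
  simp [reindex]

theorem reindex_reindex (P : Doctrine.{u, v, w} C) {A B D : C} (f : A ⟶ B) (g : B ⟶ D)
    (x : P.Fiber D) : P.reindex f (P.reindex g x) = P.reindex (f ≫ g) x := by
  simp [reindex]

/-- A doctrine is consistent if `a ≰ b` for some `a, b` in the fiber over the terminal object. -/
def IsConsistent (P : Doctrine.{u, v, w} C) : Prop :=
  ∃ a b : P.Fiber (𝟙_ C), ¬ a ≤ b

end Doctrine

/-- Primary doctrines: fibers have finite meets, preserved by reindexing. -/
class PrimaryDoctrine {C : Type u} [Category.{v} C] [CartesianMonoidalCategory C]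
    (P : Doctrine.{u, v, w} C) where
  top (A : C) : P.Fiber A
  inf {A : C} (α β : P.Fiber A) : P.Fiber A
  le_top {A : C} (α : P.Fiber A) : α ≤ top A
  inf_le_left {A : C} (α β : P.Fiber A) : inf α β ≤ α
  inf_le_right {A : C} (α β : P.Fiber A) : inf α β ≤ β
  le_inf {A : C} (α β γ : P.Fiber A) : α ≤ β → α ≤ γ → α ≤ inf β γ
  reindex_top {A B : C} (f : A ⟶ B) : P.reindex f (top B) = top A
  reindex_inf {A B : C} (f : A ⟶ B) (α β : P.Fiber B) :
    P.reindex f (inf α β) = inf (P.reindex f α) (P.reindex f β)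

section Structure

variable {C : Type u} [Category.{v} C] [CartesianMonoidalCategory C]

instance PrimaryDoctrine.instSemilatticeInf (P : Doctrine.{u, v, w} C) [PrimaryDoctrine P]
    (A : C) : SemilatticeInf (P.Fiber A) where
  inf := PrimaryDoctrine.inf
  inf_le_left := PrimaryDoctrine.inf_le_left
  inf_le_right := PrimaryDoctrine.inf_le_right
  le_inf := PrimaryDoctrine.le_inf

instance PrimaryDoctrine.instOrderTop (P : Doctrine.{u, v, w} C) [PrimaryDoctrine P]
    (A : C) : OrderTop (P.Fiber A) where
  top := PrimaryDoctrine.top A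
  le_top := PrimaryDoctrine.le_top

/-- Implicational doctrines: the fibers are cartesian closed, with `imp` preserved by
reindexing. -/
class ImplicationalDoctrine (P : Doctrine.{u, v, w} C) [PrimaryDoctrine P] where
  imp {A : C} (α β : P.Fiber A) : P.Fiber A
  le_imp_iff {A : C} (γ α β : P.Fiber A) : γ ≤ imp α β ↔ γ ⊓ α ≤ β
  reindex_imp {A B : C} (f : A ⟶ B) (α β : P.Fiber B) :
    P.reindex f (imp α β) = imp (P.reindex f α) (P.reindex f β)

/-- Existential doctrines: `ex A B` is the left adjoint of the reindexing along the projection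
`A ⊗ B ⟶ A`, with the Beck-Chevalley condition and Frobenius reciprocity. -/
class ExistentialDoctrine (P : Doctrine.{u, v, w} C) [PrimaryDoctrine P] where
  ex (A B : C) : P.Fiber (A ⊗ B) → P.Fiber A
  gc (A B : C) : GaloisConnection (ex A B) (P.reindex (fst A B))
  beckChevalley {A A' : C} (B : C) (f : A ⟶ A') (α : P.Fiber (A' ⊗ B)) :
    ex A B (P.reindex (f ▷ B) α) = P.reindex f (ex A' B α)
  frobenius (A B : C) (α : P.Fiber (A ⊗ B)) (β : P.Fiber A) :
    ex A B (α ⊓ P.reindex (fst A B) β) = ex A B α ⊓ β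

/-- Bounded doctrines (the top element being the one of the primary structure): fibers have a
bottom element, preserved by reindexing. -/
class BoundedDoctrine (P : Doctrine.{u, v, w} C) [PrimaryDoctrine P] where
  bot (A : C) : P.Fiber A
  bot_le {A : C} (α : P.Fiber A) : bot A ≤ α
  reindex_bot {A B : C} (f : A ⟶ B) : P.reindex f (bot B) = bot A

end Structure

/-! ### Directed colimits of sets and of posets -/

/-- The colimit of a directed system of sets: `(i, a)` and `(j, b)` are identified when `a` and `b`
have the same image at some `k ≥ i, j`. -/
def DirColim {ι : Type*} [Preorder ι] [IsDirectedOrder ι] {F : ι → Type*}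
    (f : ∀ ⦃i j⦄, i ≤ j → F i → F j) [DirectedSystem F f] : Type _ :=
  Quotient (α := Σ i, F i)
    { r := fun x y => ∃ (k : ι) (hx : x.1 ≤ k) (hy : y.1 ≤ k), f hx x.2 = f hy y.2
      iseqv :=
        ⟨fun x => ⟨x.1, le_rfl, le_rfl, rfl⟩, fun ⟨k, hx, hy, e⟩ => ⟨k, hy, hx, e.symm⟩,
          fun ⟨k, hx, _, e⟩ ⟨l, _, hz, e'⟩ =>
            have ⟨m, hkm, hlm⟩ := exists_ge_ge k l
            ⟨m, hx.trans hkm, hz.trans hlm, by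
              have e₁ := congrArg (f hkm) e
              have e₂ := congrArg (f hlm) e'
              simp only [DirectedSystem.map_map (f := f)] at e₁ e₂
              exact e₁.trans e₂⟩⟩ }

namespace DirColim

section Sets

variable {ι : Type*} [Preorder ι] [IsDirectedOrder ι] {F F₁ F₂ : ι → Type*}
  (f : ∀ ⦃i j⦄, i ≤ j → F i → F j) [DirectedSystem F f]
  (f₁ : ∀ ⦃i j⦄, i ≤ j → F₁ i → F₁ j) [DirectedSystem F₁ f₁]
  (f₂ : ∀ ⦃i j⦄, i ≤ j → F₂ i → F₂ j) [DirectedSystem F₂ f₂]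

/-- The class of `(i, a)`. -/
def mk (i : ι) (a : F i) : DirColim f := Quotient.mk _ ⟨i, a⟩

theorem mk_eq_mk {i j : ι} {a : F i} {b : F j} :
    mk f i a = mk f j b ↔ ∃ (k : ι) (hi : i ≤ k) (hj : j ≤ k), f hi a = f hj b :=
  ⟨fun h => Quotient.exact h, fun h => Quotient.sound h⟩

@[simp]
theorem mk_map {i j : ι} (h : i ≤ j) (a : F i) : mk f j (f h a) = mk f i a :=
  (mk_eq_mk f).2 ⟨j, le_rfl, h, DirectedSystem.map_self _⟩

theorem exists_eq_mk (x : DirColim f) : ∃ i a, x = mk f i a := by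
  obtain ⟨i, a⟩ := x
  exact ⟨i, a, rfl⟩

theorem exists_eq_mk_of_ge (x : DirColim f) (i : ι) : ∃ j, i ≤ j ∧ ∃ a, x = mk f j a := by
  obtain ⟨j, a, rfl⟩ := exists_eq_mk f x
  obtain ⟨k, hi, hj⟩ := exists_ge_ge i j
  exact ⟨k, hi, f hj a, (mk_map f hj a).symm⟩

theorem exists_eq_mk₂ (x : DirColim f₁) (y : DirColim f₂) :
    ∃ i a b, x = mk f₁ i a ∧ y = mk f₂ i b := by
  obtain ⟨i, a, rfl⟩ := exists_eq_mk f₁ x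
  obtain ⟨j, hij, b, rfl⟩ := exists_eq_mk_of_ge f₂ y i
  exact ⟨j, f₁ hij a, b, (mk_map f₁ hij a).symm, rfl⟩

/-- Binary operations on directed colimits, computed at a common index. -/
def map₂ (g : ∀ i, F₁ i → F₂ i → F i)
    (hg : ∀ ⦃i j⦄ (h : i ≤ j) a b, f h (g i a b) = g j (f₁ h a) (f₂ h b)) :
    DirColim f₁ → DirColim f₂ → DirColim f :=
  Quotient.lift₂
    (fun x y => mk f (exists_ge_ge x.1 y.1).choose
      (g _ (f₁ (exists_ge_ge x.1 y.1).choose_spec.1 x.2)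
        (f₂ (exists_ge_ge x.1 y.1).choose_spec.2 y.2)))
    (by
      rintro x y x' y' ⟨k, hx, hx', e⟩ ⟨l, hy, hy', e'⟩
      obtain ⟨m, hkm, hlm⟩ := exists_ge_ge k l
      obtain ⟨n, hn₁, hn₂⟩ := exists_ge_ge (exists_ge_ge x.1 y.1).choose (exists_ge_ge x'.1 y'.1).choose
      obtain ⟨o, hmo, hno⟩ := exists_ge_ge m n
      have e₁ := congrArg (f₁ (hkm.trans hmo)) e
      have e₂ := congrArg (f₂ (hlm.trans hmo)) e'
      simp only [DirectedSystem.map_map (f := f₁)] at e₁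
      simp only [DirectedSystem.map_map (f := f₂)] at e₂
      refine (mk_eq_mk f).2 ⟨o, hn₁.trans hno, hn₂.trans hno, ?_⟩
      rw [hg, hg]
      simp only [DirectedSystem.map_map (f := f₁), DirectedSystem.map_map (f := f₂)]
      rw [e₁, e₂])

theorem map₂_mk (g : ∀ i, F₁ i → F₂ i → F i)
    (hg : ∀ ⦃i j⦄ (h : i ≤ j) a b, f h (g i a b) = g j (f₁ h a) (f₂ h b)) (i : ι) (a : F₁ i)
    (b : F₂ i) : map₂ f f₁ f₂ g hg (mk f₁ i a) (mk f₂ i b) = mk f i (g i a b) := by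
  refine (show _ = mk f _ (g _ (f₁ (exists_ge_ge i i).choose_spec.1 a)
    (f₂ (exists_ge_ge i i).choose_spec.1 b)) from rfl).trans ?_
  rw [← hg, mk_map]

end Sets

section Posets

variable {ι : Type*} [Preorder ι] [IsDirectedOrder ι] {F : ι → Type*} [∀ i, PartialOrder (F i)]
  (f : ∀ ⦃i j⦄, i ≤ j → F i →o F j) [DirectedSystem F fun _ _ h => f h]

/-- The order on the colimit of a directed system of posets. -/
instance : PartialOrder (DirColim fun _ _ h => f h) where
  le x y := ∃ i a b, x = mk _ i a ∧ y = mk _ i b ∧ a ≤ b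
  le_refl x := by
    obtain ⟨i, a, rfl⟩ := exists_eq_mk _ x
    exact ⟨i, a, a, rfl, rfl, le_rfl⟩
  le_trans := by
    rintro x y z ⟨i, a, b, rfl, rfl, hab⟩ ⟨j, c, d, hbc, rfl, hcd⟩
    obtain ⟨k, hik, hjk, e⟩ := (mk_eq_mk _).1 hbc
    refine ⟨k, f hik a, f hjk d, (mk_map (fun _ _ h => f h) hik a).symm,
      (mk_map (fun _ _ h => f h) hjk d).symm, ?_⟩
    exact ((f hik).monotone hab).trans (e.le.trans ((f hjk).monotone hcd))
  le_antisymm := by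
    rintro x y ⟨i, a, b, rfl, rfl, hab⟩ ⟨j, c, d, hbc, had, hcd⟩
    obtain ⟨k, hik, hjk, e⟩ := (mk_eq_mk _).1 hbc
    obtain ⟨l, hil, hjl, e'⟩ := (mk_eq_mk _).1 had
    obtain ⟨m, hkm, hlm⟩ := exists_ge_ge k l
    have e₁ := congrArg (f hkm) e
    have e₂ := congrArg (f hlm) e'
    simp only [DirectedSystem.map_map (f := fun _ _ h => f h)] at e₁ e₂
    refine (mk_eq_mk _).2 ⟨m, hik.trans hkm, hik.trans hkm, le_antisymm ?_ ?_⟩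
    · exact (f _).monotone hab
    · exact e₁.le.trans (((f _).monotone hcd).trans e₂.ge)

theorem mk_le_mk {i j : ι} {a : F i} {b : F j} :
    (mk (fun _ _ h => f h) i a) ≤ mk (fun _ _ h => f h) j b ↔
      ∃ (k : ι) (hi : i ≤ k) (hj : j ≤ k), f hi a ≤ f hj b := by
  constructor
  · rintro ⟨k, c, d, hac, hbd, hcd⟩
    obtain ⟨l, hil, hkl, e⟩ := (mk_eq_mk _).1 hac
    obtain ⟨m, hjm, hkm, e'⟩ := (mk_eq_mk _).1 hbd
    obtain ⟨n, hln, hmn⟩ := exists_ge_ge l m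
    have e₁ := congrArg (f hln) e
    have e₂ := congrArg (f hmn) e'
    simp only [DirectedSystem.map_map (f := fun _ _ h => f h)] at e₁ e₂
    exact ⟨n, hil.trans hln, hjm.trans hmn, e₁.le.trans (((f _).monotone hcd).trans e₂.ge)⟩
  · rintro ⟨k, hi, hj, h⟩
    exact ⟨k, _, _, (mk_map (fun _ _ h => f h) hi a).symm,
      (mk_map (fun _ _ h => f h) hj b).symm, h⟩

end Posets

end DirColim

/-! ### Adding constants -/

/-- Finite lists with different entries of pairs `(X, x)`: a sort `X` and a label `x` in `Λ`. -/
def ConstList (C : Type u) (Λ : Type t) : Type (max u t) :=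
  {l : List (C × Λ) // l.Nodup}

namespace ConstList

variable {C : Type u} {Λ : Type t}

instance : Preorder (ConstList C Λ) where
  le l m := ∀ p ∈ l.1, p ∈ m.1
  le_refl _ _ h := h
  le_trans _ _ _ h h' p hp := h' p (h p hp)

open Classical in
instance : IsDirectedOrder (ConstList C Λ) where
  directed l m := ⟨⟨(l.1 ++ m.1).dedup, List.nodup_dedup _⟩,
    fun p hp => by simp [hp], fun p hp => by simp [hp]⟩

/-- The empty list. -/
def nil : ConstList C Λ := ⟨[], List.nodup_nil⟩

theorem nil_le (l : ConstList C Λ) : nil ≤ l := fun p hp => by simp [nil] at hp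

/-- Adding a new pair at the end of a list. -/
def snoc (l : ConstList C Λ) (p : C × Λ) (hp : p ∉ l.1) : ConstList C Λ :=
  ⟨l.1 ++ [p], l.2.append (List.nodup_singleton p) (by simpa using hp)⟩

theorem le_snoc (l : ConstList C Λ) (p : C × Λ) (hp : p ∉ l.1) : l ≤ l.snoc p hp :=
  fun q hq => by simp [snoc, hq]

theorem mem_snoc (l : ConstList C Λ) (p : C × Λ) (hp : p ∉ l.1) : p ∈ (l.snoc p hp).1 := by
  simp [snoc]

variable [Category.{v} C] [CartesianMonoidalCategory C]

instance (l : ConstList C Λ) : Finite {p // p ∈ l.1} := l.1.finite_toSet.to_subtype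

/-- The product `∏ Xₐ` of the sorts of a list `((X₁, x₁), …, (Xₙ, xₙ))`; the factors are indexed
by the entries of the list. -/
def ctx (l : ConstList C Λ) : C := ∏ᶜ fun p : {p // p ∈ l.1} => p.1.1

/-- The projection onto the factor given by an entry of the list. -/
def proj (l : ConstList C Λ) (p : C × Λ) (hp : p ∈ l.1) : l.ctx ⟶ p.1 :=
  Limits.Pi.π (fun p : {p // p ∈ l.1} => p.1.1) ⟨p, hp⟩

/-- The projection `∏ Y_b ⟶ ∏ Xₐ` induced by an inclusion of lists. -/
def restr {l m : ConstList C Λ} (h : l ≤ m) : m.ctx ⟶ l.ctx :=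
  Limits.Pi.lift fun p => m.proj p.1 (h _ p.2)

theorem hom_ext {l : ConstList C Λ} {A : C} {f g : A ⟶ l.ctx}
    (h : ∀ p hp, f ≫ l.proj p hp = g ≫ l.proj p hp) : f = g :=
  Limits.Pi.hom_ext _ _ fun p => h p.1 p.2

@[simp]
theorem restr_proj {l m : ConstList C Λ} (h : l ≤ m) (p : C × Λ) (hp : p ∈ l.1) :
    restr h ≫ l.proj p hp = m.proj p (h p hp) :=
  Limits.Pi.lift_π _ _

@[simp]
theorem restr_self (l : ConstList C Λ) : restr (le_refl l) = 𝟙 l.ctx :=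
  hom_ext fun p hp => by simp

@[simp]
theorem restr_restr {l m n : ConstList C Λ} (h : l ≤ m) (h' : m ≤ n) :
    restr h' ≫ restr h = restr (h.trans h') :=
  hom_ext fun p hp => by simp

end ConstList

open ConstList

/-- The objects of the category in which constants labelled by `Λ` are added: those of `C`. -/
@[ext]
structure ConstCat (C : Type u) (Λ : Type t) : Type u where
  base : C

namespace ConstCat

variable {C : Type u} [Category.{v} C] [CartesianMonoidalCategory C] {Λ : Type t}

/-- The transition map between the arrows `A ⇝ B` of two Kleisli categories. -/
def homTrans (A B : C) (l m : ConstList C Λ) (h : l ≤ m) (f : l.ctx ⊗ A ⟶ B) : m.ctx ⊗ A ⟶ B :=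
  restr h ▷ A ≫ f

instance (A B : C) : DirectedSystem (fun l : ConstList C Λ => (l.ctx ⊗ A ⟶ B))
    (homTrans A B · · ·) where
  map_self l f := by simp [homTrans]
  map_map l m n h h' f := by simp [homTrans, ← comp_whiskerRight_assoc]

/-- Arrows `A ⇢ B`: classes of arrows `∏ Xₐ ⊗ A ⟶ B`. -/
def Hom (A B : ConstCat C Λ) : Type (max u v t) :=
  DirColim (F := fun l : ConstList C Λ => (l.ctx ⊗ A.base ⟶ B.base)) (homTrans A.base B.base · · ·)

/-- The class `[f, X̄]` of an arrow `f : ∏ Xₐ ⊗ A ⟶ B`. -/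
def Hom.mk {A B : ConstCat C Λ} (l : ConstList C Λ) (f : l.ctx ⊗ A.base ⟶ B.base) : Hom A B :=
  DirColim.mk (F := fun l : ConstList C Λ => (l.ctx ⊗ A.base ⟶ B.base)) _ l f

theorem Hom.mk_eq_mk {A B : ConstCat C Λ} {l m : ConstList C Λ} {f : l.ctx ⊗ A.base ⟶ B.base}
    {g : m.ctx ⊗ A.base ⟶ B.base} : Hom.mk l f = Hom.mk m g ↔
      ∃ (k : ConstList C Λ) (hl : l ≤ k) (hm : m ≤ k), restr hl ▷ _ ≫ f = restr hm ▷ _ ≫ g :=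
  DirColim.mk_eq_mk _

theorem Hom.mk_restr {A B : ConstCat C Λ} {l m : ConstList C Λ} (h : l ≤ m)
    (f : l.ctx ⊗ A.base ⟶ B.base) : (Hom.mk m (restr h ▷ _ ≫ f) : Hom A B) = Hom.mk l f :=
  DirColim.mk_map (F := fun l : ConstList C Λ => (l.ctx ⊗ A.base ⟶ B.base)) _ h f

theorem Hom.exists_eq_mk_of_ge {A B : ConstCat C Λ} (f : Hom A B) (l : ConstList C Λ) :
    ∃ m, l ≤ m ∧ ∃ f' : m.ctx ⊗ A.base ⟶ B.base, f = Hom.mk m f' :=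
  DirColim.exists_eq_mk_of_ge _ f l

theorem Hom.exists_eq_mk {A B : ConstCat C Λ} (f : Hom A B) :
    ∃ (m : ConstList C Λ) (f' : m.ctx ⊗ A.base ⟶ B.base), f = Hom.mk m f' :=
  DirColim.exists_eq_mk _ f

/-- Composition, computed in the Kleisli category of a common list. -/
def Hom.comp {A B D : ConstCat C Λ} (f : Hom A B) (g : Hom B D) : Hom A D :=
  DirColim.map₂ (F := fun l : ConstList C Λ => (l.ctx ⊗ A.base ⟶ D.base))
    (homTrans A.base D.base · · ·) (homTrans A.base B.base · · ·) (homTrans B.base D.base · · ·)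
    (fun _ f' g' => lift (fst _ _) f' ≫ g')
    (by intros; simp [homTrans, comp_lift_assoc]) f g

theorem Hom.comp_mk {A B D : ConstCat C Λ} (l : ConstList C Λ) (f : l.ctx ⊗ A.base ⟶ B.base)
    (g : l.ctx ⊗ B.base ⟶ D.base) :
    (Hom.mk l f).comp (Hom.mk l g) = (Hom.mk l (lift (fst _ _) f ≫ g) : Hom A D) :=
  DirColim.map₂_mk (F := fun l : ConstList C Λ => (l.ctx ⊗ A.base ⟶ D.base))
    (F₁ := fun l : ConstList C Λ => (l.ctx ⊗ A.base ⟶ B.base))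
    (F₂ := fun l : ConstList C Λ => (l.ctx ⊗ B.base ⟶ D.base)) _ _ _ _ _ l f g

instance : Category.{max u v t} (ConstCat C Λ) where
  Hom := Hom
  id A := Hom.mk nil (snd _ _)
  comp := Hom.comp
  id_comp f := by
    obtain ⟨l, f, rfl⟩ := Hom.exists_eq_mk f
    rw [← Hom.mk_restr (nil_le l), Hom.comp_mk]
    simp
  comp_id f := by
    obtain ⟨l, f, rfl⟩ := Hom.exists_eq_mk f
    rw [← Hom.mk_restr (nil_le l) (snd _ _), Hom.comp_mk]
    simp
  assoc f g h := by
    obtain ⟨l, f, rfl⟩ := Hom.exists_eq_mk f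
    obtain ⟨m, hm, g, rfl⟩ := Hom.exists_eq_mk_of_ge g l
    obtain ⟨n, hn, h, rfl⟩ := Hom.exists_eq_mk_of_ge h m
    rw [← Hom.mk_restr (hm.trans hn) f, ← Hom.mk_restr hn g]
    simp only [Hom.comp_mk]
    simp [comp_lift_assoc]

/-- The arrow `[f, X̄] : A ⇢ B` represented by `f : ∏ Xₐ ⊗ A ⟶ B`. -/
def homMk {A B : ConstCat C Λ} (l : ConstList C Λ) (f : l.ctx ⊗ A.base ⟶ B.base) : A ⟶ B :=
  Hom.mk l f

theorem homMk_comp {A B D : ConstCat C Λ} (l : ConstList C Λ) (f : l.ctx ⊗ A.base ⟶ B.base)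
    (g : l.ctx ⊗ B.base ⟶ D.base) :
    homMk l f ≫ homMk l g = (homMk l (lift (fst _ _) f ≫ g) : A ⟶ D) :=
  Hom.comp_mk l f g

theorem homMk_restr {A B : ConstCat C Λ} {l m : ConstList C Λ} (h : l ≤ m)
    (f : l.ctx ⊗ A.base ⟶ B.base) : (homMk m (restr h ▷ _ ≫ f) : A ⟶ B) = homMk l f :=
  Hom.mk_restr h f

theorem exists_eq_homMk_of_ge {A B : ConstCat C Λ} (f : A ⟶ B) (l : ConstList C Λ) :
    ∃ m, l ≤ m ∧ ∃ f' : m.ctx ⊗ A.base ⟶ B.base, f = homMk m f' :=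
  Hom.exists_eq_mk_of_ge f l

theorem exists_eq_homMk {A B : ConstCat C Λ} (f : A ⟶ B) :
    ∃ (m : ConstList C Λ) (f' : m.ctx ⊗ A.base ⟶ B.base), f = homMk m f' :=
  Hom.exists_eq_mk f

theorem homMk_eq_homMk {A B : ConstCat C Λ} {l m : ConstList C Λ}
    {f : l.ctx ⊗ A.base ⟶ B.base} {g : m.ctx ⊗ A.base ⟶ B.base} :
    (homMk l f : A ⟶ B) = homMk m g ↔
      ∃ (k : ConstList C Λ) (hl : l ≤ k) (hm : m ≤ k), restr hl ▷ _ ≫ f = restr hm ▷ _ ≫ g :=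
  Hom.mk_eq_mk

/-- The terminal object of the category with constants is that of `C`. -/
def terminalCone : Limits.LimitCone (Functor.empty.{0} (ConstCat C Λ)) where
  cone := Limits.asEmptyCone ⟨𝟙_ C⟩
  isLimit := Limits.IsTerminal.ofUniqueHom (fun A => homMk nil (toUnit _)) fun A f => by
    obtain ⟨l, f, rfl⟩ := exists_eq_homMk f
    exact homMk_eq_homMk.2 ⟨l, le_rfl, nil_le l, toUnit_unique _ _⟩

/-- The projections of `A × B`, and the pairing of two arrows. -/
def fstC (A B : ConstCat C Λ) : (⟨A.base ⊗ B.base⟩ : ConstCat C Λ) ⟶ A :=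
  homMk nil (snd _ _ ≫ fst _ _)

/-- The second projection. -/
def sndC (A B : ConstCat C Λ) : (⟨A.base ⊗ B.base⟩ : ConstCat C Λ) ⟶ B :=
  homMk nil (snd _ _ ≫ snd _ _)

/-- The pairing of two arrows. -/
def liftC {A B D : ConstCat C Λ} (f : D ⟶ A) (g : D ⟶ B) :
    D ⟶ (⟨A.base ⊗ B.base⟩ : ConstCat C Λ) :=
  DirColim.map₂ (F := fun l : ConstList C Λ => (l.ctx ⊗ D.base ⟶ A.base ⊗ B.base))
    (homTrans D.base (A.base ⊗ B.base) · · ·) (homTrans D.base A.base · · ·)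
    (homTrans D.base B.base · · ·) (fun _ f' g' => lift f' g') (by intros; simp [homTrans]) f g

theorem liftC_homMk {A B D : ConstCat C Λ} (l : ConstList C Λ) (f : l.ctx ⊗ D.base ⟶ A.base)
    (g : l.ctx ⊗ D.base ⟶ B.base) :
    liftC (homMk l f : D ⟶ A) (homMk l g) = homMk l (lift f g) :=
  DirColim.map₂_mk (F := fun l : ConstList C Λ => (l.ctx ⊗ D.base ⟶ A.base ⊗ B.base))
    (F₁ := fun l : ConstList C Λ => (l.ctx ⊗ D.base ⟶ A.base))
    (F₂ := fun l : ConstList C Λ => (l.ctx ⊗ D.base ⟶ B.base)) _ _ _ _ _ l f g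

theorem homMk_fstC {A B D : ConstCat C Λ} (l : ConstList C Λ)
    (f : l.ctx ⊗ D.base ⟶ A.base ⊗ B.base) :
    (homMk l f : D ⟶ ⟨A.base ⊗ B.base⟩) ≫ fstC A B = homMk l (f ≫ fst _ _) := by
  rw [fstC, ← homMk_restr (nil_le l), homMk_comp]
  simp

theorem homMk_sndC {A B D : ConstCat C Λ} (l : ConstList C Λ)
    (f : l.ctx ⊗ D.base ⟶ A.base ⊗ B.base) :
    (homMk l f : D ⟶ ⟨A.base ⊗ B.base⟩) ≫ sndC A B = homMk l (f ≫ snd _ _) := by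
  rw [sndC, ← homMk_restr (nil_le l), homMk_comp]
  simp

theorem liftC_fstC {A B D : ConstCat C Λ} (f : D ⟶ A) (g : D ⟶ B) : liftC f g ≫ fstC A B = f := by
  obtain ⟨l, f, rfl⟩ := exists_eq_homMk f
  obtain ⟨m, hm, g, rfl⟩ := exists_eq_homMk_of_ge g l
  rw [← homMk_restr hm, liftC_homMk, homMk_fstC, lift_fst]

theorem liftC_sndC {A B D : ConstCat C Λ} (f : D ⟶ A) (g : D ⟶ B) : liftC f g ≫ sndC A B = g := by
  obtain ⟨l, f, rfl⟩ := exists_eq_homMk f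
  obtain ⟨m, hm, g, rfl⟩ := exists_eq_homMk_of_ge g l
  rw [← homMk_restr hm, liftC_homMk, homMk_sndC, lift_snd]

theorem liftC_comp {A B D : ConstCat C Λ} (f : D ⟶ ⟨A.base ⊗ B.base⟩) :
    liftC (f ≫ fstC A B) (f ≫ sndC A B) = f := by
  obtain ⟨l, f, rfl⟩ := exists_eq_homMk f
  rw [homMk_fstC, homMk_sndC, liftC_homMk, lift_comp_fst_snd]

/-- The product of two objects in the category with constants is that of `C`. -/
def prodCone (A B : ConstCat C Λ) : Limits.LimitCone (Limits.pair A B) where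
  cone := Limits.BinaryFan.mk (fstC A B) (sndC A B)
  isLimit := Limits.BinaryFan.IsLimit.mk _ (fun f g => liftC f g) (fun f g => liftC_fstC f g)
    (fun f g => liftC_sndC f g) (by
      rintro D f g m rfl rfl
      exact (liftC_comp m).symm)

instance : CartesianMonoidalCategory (ConstCat C Λ) :=
  CartesianMonoidalCategory.ofChosenFiniteProducts terminalCone prodCone

end ConstCat

namespace Doctrine

section AddConstants

variable {C : Type u} [Category.{v} C] [CartesianMonoidalCategory C] (P : Doctrine.{u, v, w} C)
  {Λ : Type t}

/-- The transition map `P(∏ Xₐ ⊗ A) → P(∏ Y_b ⊗ A)` for an inclusion of lists. -/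
def constTrans (A : C) ⦃l m : ConstList C Λ⦄ (h : l ≤ m) :
    P.Fiber (l.ctx ⊗ A) →o P.Fiber (m.ctx ⊗ A) :=
  P.reindex (restr h ▷ A)

instance (A : C) : DirectedSystem (fun l : ConstList C Λ => P.Fiber (l.ctx ⊗ A))
    fun _ _ h => P.constTrans A h where
  map_self l x := by simp [constTrans, reindex_id]
  map_map l m n h h' x := by simp [constTrans, reindex_reindex, ← comp_whiskerRight]

/-- The fibers of the doctrine with constants: classes of elements of `P(∏ Xₐ ⊗ A)`. -/
abbrev ConstFiber (A : ConstCat C Λ) : Type (max u w t) :=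
  DirColim (F := fun l : ConstList C Λ => P.Fiber (l.ctx ⊗ A.base))
    fun _ _ h => P.constTrans A.base h

/-- The class `[α, X̄]` of an element `α` of `P(∏ Xₐ ⊗ A)`. -/
def constMk {A : ConstCat C Λ} (l : ConstList C Λ) (α : P.Fiber (l.ctx ⊗ A.base)) :
    P.ConstFiber A :=
  DirColim.mk (F := fun l : ConstList C Λ => P.Fiber (l.ctx ⊗ A.base)) _ l α

theorem constMk_trans {A : ConstCat C Λ} {l m : ConstList C Λ} (h : l ≤ m)
    (α : P.Fiber (l.ctx ⊗ A.base)) :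
    (P.constMk m (P.reindex (restr h ▷ _) α) : P.ConstFiber A) = P.constMk l α :=
  DirColim.mk_map (fun _ _ h => P.constTrans A.base h) h α

theorem exists_eq_constMk {A : ConstCat C Λ} (x : P.ConstFiber A) :
    ∃ l α, x = P.constMk l α :=
  DirColim.exists_eq_mk _ x

theorem exists_eq_constMk_of_ge {A : ConstCat C Λ} (x : P.ConstFiber A) (l : ConstList C Λ) :
    ∃ m, l ≤ m ∧ ∃ α, x = P.constMk m α :=
  DirColim.exists_eq_mk_of_ge _ x l

theorem constMk_le {A : ConstCat C Λ} {l m : ConstList C Λ} {α : P.Fiber (l.ctx ⊗ A.base)}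
    {β : P.Fiber (m.ctx ⊗ A.base)} :
    (P.constMk l α : P.ConstFiber A) ≤ P.constMk m β ↔
      ∃ (k : ConstList C Λ) (hl : l ≤ k) (hm : m ≤ k),
        P.reindex (restr hl ▷ _) α ≤ P.reindex (restr hm ▷ _) β :=
  DirColim.mk_le_mk fun _ _ h => P.constTrans A.base h

/-- Reindexing in the doctrine with constants, computed at a common list. -/
def constReindexFun {A B : ConstCat C Λ} (f : A ⟶ B) (x : P.ConstFiber B) : P.ConstFiber A :=
  DirColim.map₂ (F := fun l : ConstList C Λ => P.Fiber (l.ctx ⊗ A.base))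
    (F₂ := fun l : ConstList C Λ => P.Fiber (l.ctx ⊗ B.base))
    (fun _ _ h => P.constTrans A.base h) (ConstCat.homTrans A.base B.base · · ·)
    (fun _ _ h => P.constTrans B.base h) (fun _ f' α => P.reindex (lift (fst _ _) f') α)
    (by intros; simp [constTrans, reindex_reindex, ConstCat.homTrans]) f x

theorem constReindexFun_mk {A B : ConstCat C Λ} (l : ConstList C Λ)
    (f : l.ctx ⊗ A.base ⟶ B.base) (α : P.Fiber (l.ctx ⊗ B.base)) :
    P.constReindexFun (ConstCat.homMk l f : A ⟶ B) (P.constMk l α) =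
      P.constMk l (P.reindex (lift (fst _ _) f) α) :=
  DirColim.map₂_mk (F := fun l : ConstList C Λ => P.Fiber (l.ctx ⊗ A.base))
    (F₁ := fun l : ConstList C Λ => (l.ctx ⊗ A.base ⟶ B.base))
    (F₂ := fun l : ConstList C Λ => P.Fiber (l.ctx ⊗ B.base)) _ _ _ _ _ l f α

theorem constReindexFun_mono {A B : ConstCat C Λ} (f : A ⟶ B) :
    Monotone (P.constReindexFun f) := by
  rintro x y ⟨l, a, b, rfl, rfl, hab⟩
  obtain ⟨m, hm, f, rfl⟩ := ConstCat.exists_eq_homMk_of_ge f l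
  change P.constReindexFun _ (P.constMk l a) ≤ P.constReindexFun _ (P.constMk l b)
  rw [← P.constMk_trans hm, ← P.constMk_trans hm, constReindexFun_mk, constReindexFun_mk]
  exact ⟨m, _, _, rfl, rfl, (P.reindex _).monotone ((P.reindex _).monotone hab)⟩

theorem constReindexFun_id (A : ConstCat C Λ) (x : P.ConstFiber A) :
    P.constReindexFun (𝟙 A) x = x := by
  obtain ⟨l, α, rfl⟩ := P.exists_eq_constMk x
  change P.constReindexFun (ConstCat.homMk nil (snd _ _)) _ = P.constMk l α
  rw [← ConstCat.homMk_restr (nil_le l), constReindexFun_mk]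
  simp [reindex_id]

theorem constReindexFun_comp {A B D : ConstCat C Λ} (f : A ⟶ B) (g : B ⟶ D)
    (x : P.ConstFiber D) :
    P.constReindexFun (f ≫ g) x = P.constReindexFun f (P.constReindexFun g x) := by
  obtain ⟨l, α, rfl⟩ := P.exists_eq_constMk x
  obtain ⟨m, hm, g, rfl⟩ := ConstCat.exists_eq_homMk_of_ge g l
  obtain ⟨n, hn, f, rfl⟩ := ConstCat.exists_eq_homMk_of_ge f m
  rw [← P.constMk_trans (hm.trans hn), ← ConstCat.homMk_restr hn g,
    ConstCat.homMk_comp, constReindexFun_mk, constReindexFun_mk, constReindexFun_mk]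
  simp [reindex_reindex]

variable (Λ) in
/-- The doctrine `P̲`, in which constants of each sort, labelled by `Λ`, are added to `P`. -/
def addConstants : Doctrine.{u, max u v t, max u w t} (ConstCat C Λ) where
  obj A := PartOrd.of (P.ConstFiber A.unop)
  map f := PartOrd.ofHom ⟨P.constReindexFun f.unop, P.constReindexFun_mono f.unop⟩
  map_id A := by
    ext x
    exact P.constReindexFun_id A.unop x
  map_comp f g := by
    ext x
    exact P.constReindexFun_comp g.unop f.unop x

theorem addConstants_reindex_mk {A B : ConstCat C Λ} (l : ConstList C Λ)
    (f : l.ctx ⊗ A.base ⟶ B.base) (α : P.Fiber (l.ctx ⊗ B.base)) :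
    (P.addConstants Λ).reindex (ConstCat.homMk l f : A ⟶ B) (P.constMk l α) =
      P.constMk l (P.reindex (lift (fst _ _) f) α) :=
  P.constReindexFun_mk l f α

/-- Meets in the doctrine with constants, computed at a common list. -/
def constInf [PrimaryDoctrine P] {A : ConstCat C Λ} (x y : P.ConstFiber A) : P.ConstFiber A :=
  DirColim.map₂ (F := fun l : ConstList C Λ => P.Fiber (l.ctx ⊗ A.base))
    (F₁ := fun l : ConstList C Λ => P.Fiber (l.ctx ⊗ A.base))
    (F₂ := fun l : ConstList C Λ => P.Fiber (l.ctx ⊗ A.base))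
    (fun _ _ h => P.constTrans A.base h) (fun _ _ h => P.constTrans A.base h)
    (fun _ _ h => P.constTrans A.base h) (fun _ α β => α ⊓ β)
    (fun _ _ _ _ _ => PrimaryDoctrine.reindex_inf _ _ _) x y

theorem constInf_mk [PrimaryDoctrine P] {A : ConstCat C Λ} (l : ConstList C Λ)
    (α β : P.Fiber (l.ctx ⊗ A.base)) :
    P.constInf (P.constMk l α : P.ConstFiber A) (P.constMk l β) = P.constMk l (α ⊓ β) :=
  DirColim.map₂_mk (F := fun l : ConstList C Λ => P.Fiber (l.ctx ⊗ A.base))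
    (F₁ := fun l : ConstList C Λ => P.Fiber (l.ctx ⊗ A.base))
    (F₂ := fun l : ConstList C Λ => P.Fiber (l.ctx ⊗ A.base)) _ _ _ _ _ l α β

theorem constMk_le_constMk {A : ConstCat C Λ} (l : ConstList C Λ)
    {α β : P.Fiber (l.ctx ⊗ A.base)} (h : α ≤ β) :
    (P.constMk l α : P.ConstFiber A) ≤ P.constMk l β :=
  ⟨l, α, β, rfl, rfl, h⟩

theorem exists_eq_constMk₂ {A : ConstCat C Λ} (x y : P.ConstFiber A) :
    ∃ l α β, x = P.constMk l α ∧ y = P.constMk l β :=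
  DirColim.exists_eq_mk₂ _ _ x y

instance [PrimaryDoctrine P] : PrimaryDoctrine (P.addConstants Λ) where
  top A := P.constMk nil ⊤
  inf x y := P.constInf x y
  le_top {A} x := by
    obtain ⟨l, α, rfl⟩ := P.exists_eq_constMk x
    refine (P.constMk_le (A := A)).2 ⟨l, le_rfl, nil_le l, ?_⟩
    exact le_top.trans (PrimaryDoctrine.reindex_top _).ge
  inf_le_left {A} x y := by
    obtain ⟨l, α, β, rfl, rfl⟩ := P.exists_eq_constMk₂ x y
    rw [constInf_mk]
    exact P.constMk_le_constMk (A := A) l inf_le_left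
  inf_le_right {A} x y := by
    obtain ⟨l, α, β, rfl, rfl⟩ := P.exists_eq_constMk₂ x y
    rw [constInf_mk]
    exact P.constMk_le_constMk (A := A) l inf_le_right
  le_inf {A} x y z := by
    rintro ⟨l, α, β, rfl, rfl, hl⟩ ⟨m, γ, δ, hm', rfl, hm⟩
    obtain ⟨k, hlk, hmk, e⟩ := (DirColim.mk_eq_mk _).1 hm'
    change P.constMk l α ≤ P.constInf (P.constMk l β) (P.constMk m δ)
    rw [← P.constMk_trans hlk, ← P.constMk_trans hlk, ← P.constMk_trans hmk, constInf_mk]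
    exact P.constMk_le_constMk (A := A) k
      (le_inf ((P.reindex _).monotone hl) (e.le.trans ((P.reindex _).monotone hm)))
  reindex_top {A B} f := by
    obtain ⟨l, f, rfl⟩ := ConstCat.exists_eq_homMk f
    rw [← P.constMk_trans (nil_le l), ← P.constMk_trans (nil_le l), addConstants_reindex_mk]
    congr 1
    exact ((congrArg _ (PrimaryDoctrine.reindex_top _)).trans
      (PrimaryDoctrine.reindex_top _)).trans (PrimaryDoctrine.reindex_top _).symm
  reindex_inf {A B} f x y := by
    obtain ⟨l, α, β, rfl, rfl⟩ := P.exists_eq_constMk₂ x y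
    obtain ⟨m, hm, f, rfl⟩ := ConstCat.exists_eq_homMk_of_ge f l
    rw [← P.constMk_trans hm, ← P.constMk_trans hm]
    simp only [constInf_mk, addConstants_reindex_mk]
    congr 1
    exact PrimaryDoctrine.reindex_inf _ _ _

end AddConstants

/-! ### Adding axioms -/

section AddSentences

variable {D : Type u} [Category.{v} D] [CartesianMonoidalCategory D] (Q : Doctrine.{u, v, w} D)
  [PrimaryDoctrine Q] {ι : Type t} (ax : ι → Q.Fiber (𝟙_ D))

/-- The conjunction of finitely many of the sentences `ax i`, reindexed to the fiber over `A`. -/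
def sentenceConj (A : D) (U : Finset ι) : Q.Fiber A := Q.reindex (toUnit A) (U.inf ax)

theorem reindex_sentenceConj {A B : D} (f : A ⟶ B) (U : Finset ι) :
    Q.reindex f (Q.sentenceConj ax B U) = Q.sentenceConj ax A U := by
  simp [sentenceConj, reindex_reindex]

theorem sentenceConj_anti (A : D) {U V : Finset ι} (h : U ⊆ V) :
    Q.sentenceConj ax A V ≤ Q.sentenceConj ax A U :=
  (Q.reindex _).monotone (Finset.inf_mono h)

/-- The fiber over `A` of the doctrine with the axioms in `U` added. -/
abbrev TheoryStage (A : D) (U : Finset ι) : Type w := {α : Q.Fiber A // α ≤ Q.sentenceConj ax A U}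

/-- The transition map from the axioms in `U` to the axioms in `V`. -/
def sentenceTrans (A : D) ⦃U V : Finset ι⦄ (_ : U ≤ V) : Q.TheoryStage ax A U →o Q.TheoryStage ax A V where
  toFun α := ⟨α.1 ⊓ Q.sentenceConj ax A V, inf_le_right⟩
  monotone' _ _ h := inf_le_inf_right _ h

instance (A : D) : DirectedSystem (Q.TheoryStage ax A) fun _ _ h => Q.sentenceTrans ax A h where
  map_self U α := Subtype.ext (inf_eq_left.2 α.2)
  map_map U V W h h' α := Subtype.ext <| by
    change α.1 ⊓ _ ⊓ _ = α.1 ⊓ _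
    rw [inf_assoc, inf_eq_right.2 (Q.sentenceConj_anti ax A h')]

open Classical in
instance finsetDirected : IsDirectedOrder (Finset ι) :=
  ⟨fun U V => ⟨U ∪ V, Finset.subset_union_left, Finset.subset_union_right⟩⟩

/-- The fibers of the doctrine in which all the axioms are added: the colimit over the finite sets
of axioms. -/
abbrev TheoryFiber (A : D) : Type (max w t) :=
  DirColim (F := Q.TheoryStage ax A) fun _ _ h => Q.sentenceTrans ax A h

/-- Reindexing at a finite set of axioms. -/
def sentenceReindexStage {A B : D} (f : A ⟶ B) (U : Finset ι) (α : Q.TheoryStage ax B U) :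
    Q.TheoryStage ax A U :=
  ⟨Q.reindex f α.1, ((Q.reindex f).monotone α.2).trans (Q.reindex_sentenceConj ax f U).le⟩

/-- Reindexing in the doctrine in which all the axioms are added. -/
def sentenceReindexFun {A B : D} (f : A ⟶ B) : Q.TheoryFiber ax B → Q.TheoryFiber ax A :=
  Quotient.lift (fun x => DirColim.mk _ x.1 (Q.sentenceReindexStage ax f x.1 x.2)) (by
    rintro ⟨U, α⟩ ⟨V, β⟩ ⟨W, hU, hV, e⟩
    refine (DirColim.mk_eq_mk _).2 ⟨W, hU, hV, Subtype.ext ?_⟩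
    have e' := congrArg (fun γ => Q.reindex f γ.1) e
    change Q.reindex f (PrimaryDoctrine.inf _ _) = Q.reindex f (PrimaryDoctrine.inf _ _) at e'
    rw [PrimaryDoctrine.reindex_inf, PrimaryDoctrine.reindex_inf, reindex_sentenceConj] at e'
    exact e')

theorem sentenceReindexFun_mk {A B : D} (f : A ⟶ B) (U : Finset ι) (α : Q.TheoryStage ax B U) :
    Q.sentenceReindexFun ax f (DirColim.mk _ U α) =
      DirColim.mk _ U (Q.sentenceReindexStage ax f U α) := rfl

theorem sentenceReindexFun_mono {A B : D} (f : A ⟶ B) : Monotone (Q.sentenceReindexFun ax f) := by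
  rintro x y ⟨U, a, b, rfl, rfl, hab⟩
  exact ⟨U, _, _, rfl, rfl, (Q.reindex f).monotone hab⟩

theorem sentenceReindexFun_id (A : D) (x : Q.TheoryFiber ax A) :
    Q.sentenceReindexFun ax (𝟙 A) x = x := by
  obtain ⟨U, α, rfl⟩ := DirColim.exists_eq_mk _ x
  rw [sentenceReindexFun_mk]
  congr 1
  exact Subtype.ext (Q.reindex_id α.1)

theorem sentenceReindexFun_comp {A B E : D} (f : A ⟶ B) (g : B ⟶ E) (x : Q.TheoryFiber ax E) :
    Q.sentenceReindexFun ax (f ≫ g) x = Q.sentenceReindexFun ax f (Q.sentenceReindexFun ax g x) := by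
  obtain ⟨U, α, rfl⟩ := DirColim.exists_eq_mk _ x
  simp only [sentenceReindexFun_mk]
  congr 1
  exact Subtype.ext (Q.reindex_reindex f g α.1).symm

/-- The doctrine obtained from `Q` by adding all the sentences `ax i` as axioms. -/
def addSentences : Doctrine.{u, v, max w t} D where
  obj A := PartOrd.of (Q.TheoryFiber ax A.unop)
  map f := PartOrd.ofHom ⟨Q.sentenceReindexFun ax f.unop, Q.sentenceReindexFun_mono ax f.unop⟩
  map_id A := by
    ext x
    exact Q.sentenceReindexFun_id ax A.unop x
  map_comp f g := by
    ext x
    exact Q.sentenceReindexFun_comp ax g.unop f.unop x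

end AddSentences

/-! ### The Henkin extension -/

section Henkin

variable {C : Type u} [Category.{v} C] [CartesianMonoidalCategory C] (P : Doctrine.{u, v, w} C)

/-- The labels of the constants: the ordinals smaller than (the initial ordinal of) the cardinality
of the disjoint union of all the fibers of `P`. -/
abbrev Labels : Type (max u w) := (Cardinal.mk (Σ X : C, P.Fiber X)).ord.ToType

/-- The choices on which the Henkin extension of `P` depends: for each object `B`, a listing
`[φ^B_j, X̄^(B,j)]`, for `j` in `Λ`, of all the elements of `P̲(B)`, with chosen representatives;
and labels `d^B_j` in `Λ` of the witnessing constants, where `d^B_j` is the smallest ordinal which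
is greater than `d^B_h` for all `h < j` and than all labels in the lists `X̄^(B,k)` for `k ≤ j`. -/
structure HenkinChoice where
  list (B : C) (j : P.Labels) : ConstList C P.Labels
  formula (B : C) (j : P.Labels) : P.Fiber ((list B j).ctx ⊗ B)
  exhaustive (B : C) (x : (P.addConstants P.Labels).Fiber ⟨B⟩) :
    ∃ j, x = P.constMk (list B j) (formula B j)
  d (B : C) (j : P.Labels) : P.Labels
  d_isLeast (B : C) (j : P.Labels) :
    IsLeast {e | (∀ h < j, d B h < e) ∧ ∀ k ≤ j, ∀ p ∈ (list B k).1, p.2 < e} (d B j)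

namespace HenkinChoice

variable {P} (H : P.HenkinChoice)

theorem fresh (B : C) (j : P.Labels) : (B, H.d B j) ∉ (H.list B j).1 :=
  fun h => lt_irrefl _ ((H.d_isLeast B j).1.2 j le_rfl _ h)

/-- The list `X̄^(B,j)_⋆`: the pair `(B, d^B_j)` is added to `X̄^(B,j)`. -/
def starList (B : C) (j : P.Labels) : ConstList C P.Labels :=
  (H.list B j).snoc (B, H.d B j) (H.fresh B j)

/-- The identification of the product of `X̄^(B,j)_⋆` (times the terminal object) with the product
of `X̄^(B,j)` times `B`. -/
def starMap (B : C) (j : P.Labels) :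
    (H.starList B j).ctx ⊗ 𝟙_ C ⟶ (H.list B j).ctx ⊗ B :=
  fst _ _ ≫ lift (restr ((H.list B j).le_snoc (B, H.d B j) (H.fresh B j)))
    ((H.starList B j).proj (B, H.d B j) ((H.list B j).mem_snoc (B, H.d B j) (H.fresh B j)))

variable [PrimaryDoctrine P] [ImplicationalDoctrine P] [ExistentialDoctrine P]

/-- The element `ψ^B_j = P(pr₁) ∃ φ^B_j → φ^B_j` of `P(∏ Xₐ ⊗ B)`. -/
def psi (B : C) (j : P.Labels) : P.Fiber ((H.list B j).ctx ⊗ B) :=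
  ImplicationalDoctrine.imp
    (P.reindex (fst _ _) (ExistentialDoctrine.ex _ B (H.formula B j))) (H.formula B j)

/-- The Henkin axiom `[ψ^B_j, X̄^(B,j)_⋆]`, a sentence of `P̲`. -/
def henkinSentence (p : C × P.Labels) :
    (P.addConstants P.Labels).Fiber (𝟙_ (ConstCat C P.Labels)) :=
  P.constMk (A := 𝟙_ (ConstCat C P.Labels)) (H.starList p.1 p.2)
    (P.reindex (H.starMap p.1 p.2) (H.psi p.1 p.2))

/-- The Henkin extension of `P`: constants labelled by `Λ` are added to `P`, and then all the
Henkin axioms. -/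
def henkinExtension :
    Doctrine.{u, max u v w, max u w} (ConstCat C P.Labels) :=
  (P.addConstants P.Labels).addSentences H.henkinSentence

end HenkinChoice

end Henkin

end Doctrine

end

/-! Consistency is a compactness argument. An inequality in the two colimits is already witnessed by
finitely many Henkin axioms over one finite list of constants, so it suffices that no finite
conjunction of axioms lies below bottom in a single fiber of `P` (`not_inf_axiomAt_le_bot`). Remove
the axioms one at a time, the one with the largest witness label first: its witnessing constant
occurs in none of the others (`notMem_starList`), so it may be replaced by a fresh variable `y`. If
`α ∧ (∃φ → φ(y))` is refutable and `y` is not in `α`, then so is `α ∧ φ(y)`, hence `α ∧ ∃φ` by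
Frobenius; then `α` implies `∃φ → φ(y)` vacuously and is itself refutable
(`le_bot_of_inf_henkin_le_bot`). What remains at the end is `⊤ ≤ ⊥`, which a non-trivial fiber
excludes.

For the existence of choices it is enough to list each `P̲(B)` so that the `j`-th list only has
labels below `j`; then `d^B_j = j`. If `Λ` is infinite, list the pairs (representative, label): each
representative recurs too often to be confined to an initial segment, so it occurs beyond its own
labels. If `Λ` is finite, the constants create no new formulas (`exists_eq_reindex_snd_of_finite`),
so the elements of `P(B)`, with empty lists, suffice. -/

open CategoryTheory MonoidalCategory CartesianMonoidalCategory Opposite ConstList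

/-! ### Replacing one constant by a variable -/

namespace ConstList

variable {C : Type u} {Λ : Type t} [Category.{v} C] [CartesianMonoidalCategory C]

open Classical in
/-- The arrow `∏ Xₐ ⊗ B ⟶ ∏ Xₐ` which replaces the coordinate `c`, of sort `B`, by the second
component. -/
noncomputable def replace (k : ConstList C Λ) (c : C × Λ) : k.ctx ⊗ c.1 ⟶ k.ctx :=
  Limits.Pi.lift fun r => if h : c = r.1 then snd _ _ ≫ eqToHom (congrArg Prod.fst h)
    else fst _ _ ≫ k.proj r.1 r.2

theorem replace_proj_self (k : ConstList C Λ) (c : C × Λ) (hc : c ∈ k.1) :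
    k.replace c ≫ k.proj c hc = snd _ _ :=
  (Limits.Pi.lift_π _ _).trans (by simp)

theorem replace_proj_of_ne (k : ConstList C Λ) {c r : C × Λ} (hr : r ∈ k.1) (h : c ≠ r) :
    k.replace c ≫ k.proj r hr = fst _ _ ≫ k.proj r hr :=
  (Limits.Pi.lift_π _ _).trans (dif_neg h)

/-- The only coordinate that changes is forgotten by the restriction. -/
theorem replace_restr {k l : ConstList C Λ} {c : C × Λ} (h : l ≤ k) (hc : c ∉ l.1) :
    k.replace c ≫ restr h = fst _ _ ≫ restr h :=
  hom_ext fun r hr => by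
    simp only [Category.assoc, restr_proj]
    exact k.replace_proj_of_ne _ fun e => hc (e ▸ hr)

end ConstList

/-! ### Eliminating a single Henkin axiom -/

namespace Doctrine

variable {C : Type u} [Category.{v} C] [CartesianMonoidalCategory C] (P : Doctrine.{u, v, w} C)

/-- Reindexing along the section is a left inverse. Thus a dummy variable of an inhabited sort
identifies no formulas, which drives the counting argument for finite doctrines. -/
theorem reindex_injective_of_section {A B : C} {f : A ⟶ B} (g : B ⟶ A) (h : g ≫ f = 𝟙 B) :
    Function.Injective (P.reindex f) :=
  Function.LeftInverse.injective (g := P.reindex g) fun x => by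
    rw [reindex_reindex, h, reindex_id]

section Primary

variable [PrimaryDoctrine P]

theorem map_inf {A B : C} (f : A ⟶ B) (α β : P.Fiber B) :
    P.reindex f (α ⊓ β) = P.reindex f α ⊓ P.reindex f β :=
  PrimaryDoctrine.reindex_inf f α β

theorem map_top {A B : C} (f : A ⟶ B) : P.reindex f (⊤ : P.Fiber B) = ⊤ :=
  PrimaryDoctrine.reindex_top f

theorem reindex_finset_inf {ι : Type*} {A B : C} (f : A ⟶ B) (s : Finset ι) (g : ι → P.Fiber B) :
    P.reindex f (s.inf g) = s.inf fun i => P.reindex f (g i) :=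
  Finset.apply_inf_eq_inf_comp (P.reindex f) (P.map_inf f) (P.map_top f)

/-- A conjunction which is refuted together with `∃ φ → φ(y)`, for a variable `y` not occurring in
it, is refuted in the presence of a term of the sort of `y`. -/
theorem le_bot_of_inf_henkin_le_bot [ImplicationalDoctrine P] [ExistentialDoctrine P]
    [BoundedDoctrine P] {A B : C} (s : A ⟶ B) (α : P.Fiber A) (φ : P.Fiber (A ⊗ B))
    (h : P.reindex (fst A B) α ⊓ ImplicationalDoctrine.imp
      (P.reindex (fst A B) (ExistentialDoctrine.ex A B φ)) φ ≤ BoundedDoctrine.bot _) :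
    α ≤ BoundedDoctrine.bot A := by
  -- Since `φ` implies `∃φ → φ`, it is refuted together with `α`. Bottom is written as a reindexed
  -- element so that the adjunction applies.
  have h₁ : φ ⊓ P.reindex (fst A B) α ≤ P.reindex (fst A B) (BoundedDoctrine.bot A) := by
    rw [BoundedDoctrine.reindex_bot]
    refine (le_inf inf_le_right (inf_le_left.trans ?_)).trans h
    exact (ImplicationalDoctrine.le_imp_iff _ _ _).2 inf_le_left
  have h₂ : ExistentialDoctrine.ex A B φ ⊓ α ≤ BoundedDoctrine.bot A := by
    rw [← ExistentialDoctrine.frobenius]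
    exact (ExistentialDoctrine.gc A B).l_le h₁
  -- By `h₂`, `α` contradicts `∃φ`, so it implies `∃φ → φ` ex falso.
  have h₃ : P.reindex (fst A B) α ≤ BoundedDoctrine.bot _ := by
    refine (le_inf le_rfl ((ImplicationalDoctrine.le_imp_iff _ _ _).2 ?_)).trans h
    rw [← map_inf, inf_comm]
    refine ((P.reindex _).monotone h₂).trans ?_
    rw [BoundedDoctrine.reindex_bot]
    exact BoundedDoctrine.bot_le _
  -- Substituting the term `s` for `y` returns to the fiber over `A`.
  have h₄ := (P.reindex (lift (𝟙 A) s)).monotone h₃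
  rwa [reindex_reindex, lift_fst, reindex_id, BoundedDoctrine.reindex_bot] at h₄

/-! ### Independence of a variable in finite doctrines -/

/-- A formula `φ(y, b)` with `φ(y₁, b) = φ(y₂, b)` does not depend on `y`. -/
theorem exists_eq_reindex_snd [ExistentialDoctrine P] {Y B : C} (φ : P.Fiber (Y ⊗ B))
    (h : P.reindex (fst Y Y ▷ B) φ = P.reindex (snd Y Y ▷ B) φ) :
    ∃ θ : P.Fiber B, φ = P.reindex (snd Y B) θ := by
  -- The witness is `∃y φ(y, b)`. One inequality is the unit of the adjunction; the other reduces by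
  -- Beck-Chevalley to `φ(y', b) ≤ φ(y, b)`, which is the hypothesis after a substitution.
  refine ⟨ExistentialDoctrine.ex B Y (P.reindex (lift (snd _ _) (fst _ _)) φ), le_antisymm ?_ ?_⟩
  · have h₁ := (P.reindex (lift (snd Y B) (fst Y B))).monotone
      ((ExistentialDoctrine.gc (P := P) B Y).le_u_l (P.reindex (lift (snd _ _) (fst _ _)) φ))
    simpa [reindex_reindex, comp_lift, reindex_id] using h₁
  · rw [← ExistentialDoctrine.beckChevalley]
    refine (ExistentialDoctrine.gc _ _).l_le ?_
    have h₁ := congrArg (P.reindex (lift (lift (snd (Y ⊗ B) Y) (fst _ _ ≫ fst _ _))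
      (fst (Y ⊗ B) Y ≫ snd _ _))) h
    rw [reindex_reindex, reindex_reindex] at h₁
    rw [reindex_reindex]
    refine (Eq.trans ?_ (h₁.trans ?_)).le
    · congr 2
      ext <;> simp
    · congr 2
      ext <;> simp

/-- If there are finitely many formulas, then a formula `φ(m, b)` whose variable `m` has a sort with
terms of all other sorts does not depend on `m`. -/
theorem exists_eq_reindex_snd_of_finite [ExistentialDoctrine P] [Finite (Σ X : C, P.Fiber X)]
    {M B : C} (hM : ∀ X : C, Nonempty (M ⟶ X)) (φ : P.Fiber (M ⊗ B)) :
    ∃ θ : P.Fiber B, φ = P.reindex (snd M B) θ := by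
  have (X : C) : Finite (P.Fiber X) := Finite.of_injective (Sigma.mk X) sigma_mk_injective
  have : Finite C := Finite.of_injective (fun X => (⟨X, ⊤⟩ : Σ X : C, P.Fiber X))
    fun _ _ h => congrArg Sigma.fst h
  -- Among the objects over `M`, take one for which `P(Y ⊗ B)` is as large as possible.
  obtain ⟨Y, ⟨⟨g⟩, hY⟩⟩ := (Set.toFinite {Y : C | Nonempty (Y ⟶ M)}).exists_maximalFor
    (fun Y => Nat.card (P.Fiber (Y ⊗ B))) _ ⟨M, ⟨𝟙 M⟩⟩
  obtain ⟨g'⟩ := hM Y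
  -- Along a split epimorphism from such a `Z` the reindexing is injective; maximality of `Y` makes
  -- it bijective.
  have key {Z : C} (f s) (hs : s ≫ f = 𝟙 Y) (hZ : Z ⟶ M) :
      Function.Bijective (P.reindex ((f : Z ⟶ Y) ▷ B)) :=
    have hi := P.reindex_injective_of_section (f := f ▷ B) (s ▷ B) (by
      rw [← comp_whiskerRight, hs, id_whiskerRight])
    hi.bijective_of_nat_card_le (hY ⟨hZ⟩ (Nat.card_le_card_of_injective _ hi))
  have hconst (ψ : P.Fiber (Y ⊗ B)) : ∃ θ : P.Fiber B, ψ = P.reindex (snd Y B) θ := by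
    refine P.exists_eq_reindex_snd ψ ?_
    -- Surjectivity gives `ψ(y₁) = χ(y₂)`; on the diagonal `χ = ψ`, hence `ψ(y₁) = ψ(y₂)`.
    obtain ⟨χ, hχ⟩ := (key (snd Y Y) (lift (𝟙 Y) (𝟙 Y)) (lift_snd _ _) (fst _ _ ≫ g)).2
      (P.reindex (fst Y Y ▷ B) ψ)
    have h := congrArg (P.reindex (lift (𝟙 Y) (𝟙 Y) ▷ B)) hχ
    simp only [reindex_reindex, ← comp_whiskerRight, lift_fst, lift_snd, id_whiskerRight,
      reindex_id] at h
    rw [← hχ, h]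
  -- Over `M ⊗ Y`, the formula `φ(m)` equals some `ψ(y)`, and this is constant by `hconst`. The
  -- arrow `g' : M ⟶ Y` then allows the dummy `y` to be cancelled.
  obtain ⟨ψ, hψ⟩ := (key (snd M Y) (lift g (𝟙 Y)) (lift_snd _ _) (fst _ _)).2
    (P.reindex (fst M Y ▷ B) φ)
  obtain ⟨θ, rfl⟩ := hconst ψ
  refine ⟨θ, P.reindex_injective_of_section (f := fst M Y ▷ B) (lift (𝟙 M) g' ▷ B) ?_ ?_⟩
  · rw [← comp_whiskerRight, lift_fst, id_whiskerRight]
  · rw [← hψ, reindex_reindex, reindex_reindex]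
    simp

end Primary

end Doctrine

/-! ### Consistency for every choice -/

namespace Doctrine

variable {C : Type u} [Category.{v} C] [CartesianMonoidalCategory C] {P : Doctrine.{u, v, w} C}

/-- Compactness: an inequality between the classes of `⊤` and `b` is witnessed at a finite set of
axioms, whose conjunction would then lie below `b`. -/
theorem addSentences_isConsistent {D : Type u} [Category.{v} D] [CartesianMonoidalCategory D]
    (Q : Doctrine.{u, v, w} D) [PrimaryDoctrine Q] {ι : Type t} (ax : ι → Q.Fiber (𝟙_ D))
    (b : Q.Fiber (𝟙_ D)) (h : ∀ U : Finset ι, ¬ U.inf ax ≤ b) :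
    (Q.addSentences ax).IsConsistent := by
  let x : Q.TheoryFiber ax (𝟙_ D) := DirColim.mk _ ∅ ⟨Q.sentenceConj ax _ ∅, le_rfl⟩
  let y : Q.TheoryFiber ax (𝟙_ D) :=
    DirColim.mk _ ∅ ⟨b ⊓ Q.sentenceConj ax _ ∅, inf_le_right⟩
  refine ⟨x, y, fun hle => ?_⟩
  obtain ⟨U, hU, _, hle⟩ := (DirColim.mk_le_mk fun _ _ h => Q.sentenceTrans ax (𝟙_ D) h).1 hle
  have hle' : Q.sentenceConj ax (𝟙_ D) ∅ ⊓ Q.sentenceConj ax (𝟙_ D) U ≤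
    b ⊓ Q.sentenceConj ax (𝟙_ D) ∅ ⊓ Q.sentenceConj ax (𝟙_ D) U := hle
  have h₁ : Q.sentenceConj ax (𝟙_ D) U ≤ b :=
    (le_inf (Q.sentenceConj_anti ax _ hU) le_rfl).trans
      (hle'.trans (inf_le_left.trans inf_le_left))
  rw [sentenceConj, toUnit_unique (toUnit (𝟙_ D)) (𝟙 _), reindex_id] at h₁
  exact h U h₁

namespace HenkinChoice

variable (H : P.HenkinChoice)

theorem d_strictMono (B : C) : StrictMono (H.d B) := fun _ j h => (H.d_isLeast B j).1.1 _ h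

/-- A witnessing constant occurs in no list `X̄_⋆` of another axiom whose witness has a smaller
or equal label. -/
theorem notMem_starList {p q : C × P.Labels} (hne : p ≠ q) (hle : H.d q.1 q.2 ≤ H.d p.1 p.2) :
    (p.1, H.d p.1 p.2) ∉ (H.starList q.1 q.2).1 := by
  intro h
  rcases List.mem_append.1 h with h | h
  -- Labels in the unstarred list of `q` are strictly below the witness label of `q`.
  · exact hle.not_gt ((H.d_isLeast q.1 q.2).1.2 q.2 le_rfl _ h)
  -- Equal witnesses have the same sort, and within a sort the label determines the index.
  · obtain ⟨B, j⟩ := p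
    obtain ⟨B', i⟩ := q
    obtain ⟨rfl, h⟩ := Prod.mk.inj (List.mem_singleton.1 h)
    exact hne (Prod.ext rfl ((H.d_strictMono B).injective h))

/-- The arrow `∏ Y_b ⟶ ∏ Xₐ ⊗ B` for a list which contains `X̄_⋆`. -/
noncomputable def inst {k : ConstList C P.Labels} (p : C × P.Labels)
    (h : H.starList p.1 p.2 ≤ k) : k.ctx ⟶ (H.list p.1 p.2).ctx ⊗ p.1 :=
  lift (restr ((le_snoc _ _ (H.fresh p.1 p.2)).trans h))
    (k.proj (p.1, H.d p.1 p.2) (h _ (mem_snoc _ _ _)))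

theorem restr_whiskerRight_starMap {k : ConstList C P.Labels} (p : C × P.Labels)
    (h : H.starList p.1 p.2 ≤ k) :
    restr h ▷ 𝟙_ C ≫ H.starMap p.1 p.2 = fst _ _ ≫ H.inst p h := by
  rw [starMap, whiskerRight_fst_assoc, inst]
  congr 1
  rw [comp_lift]
  exact congrArg₂ lift (restr_restr _ _) (restr_proj _ _ _)

theorem replace_inst_of_notMem {k : ConstList C P.Labels} {c : C × P.Labels} (p : C × P.Labels)
    (h : H.starList p.1 p.2 ≤ k) (hc : c ∉ (H.starList p.1 p.2).1) :
    k.replace c ≫ H.inst p h = fst _ _ ≫ H.inst p h := by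
  rw [inst, comp_lift, comp_lift]
  refine congrArg₂ lift (replace_restr _ fun hc' => hc (le_snoc _ _ (H.fresh p.1 p.2) _ hc')) ?_
  exact replace_proj_of_ne _ _ fun e => hc (e ▸ mem_snoc _ _ (H.fresh p.1 p.2))

/-- By freshness the witness is not among the constants of the formula itself, so only the
coordinate of sort `B` becomes the variable. -/
theorem replace_inst_self {k : ConstList C P.Labels} (p : C × P.Labels)
    (h : H.starList p.1 p.2 ≤ k) :
    k.replace (p.1, H.d p.1 p.2) ≫ H.inst p h =
      restr ((le_snoc _ _ (H.fresh p.1 p.2)).trans h) ▷ p.1 := by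
  rw [inst, comp_lift]
  refine (congrArg₂ lift (replace_restr _ (H.fresh p.1 p.2)) (replace_proj_self _ _ _)).trans ?_
  ext <;> simp

theorem exists_starList_le (U : Finset (C × P.Labels)) :
    ∃ k, ∀ p ∈ U, H.starList p.1 p.2 ≤ k := by
  classical
  have : Nonempty (ConstList C P.Labels) := ⟨nil⟩
  obtain ⟨k, hk⟩ := (U.image fun p => H.starList p.1 p.2).exists_le
  exact ⟨k, fun p hp => hk _ (Finset.mem_image_of_mem _ hp)⟩

theorem restr_inst {k m : ConstList C P.Labels} (p : C × P.Labels)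
    (h : H.starList p.1 p.2 ≤ k) (hkm : k ≤ m) :
    restr hkm ≫ H.inst p h = H.inst p (h.trans hkm) := by
  rw [inst, comp_lift]
  exact congrArg₂ lift (restr_restr _ _) (restr_proj _ _ _)

variable [PrimaryDoctrine P] [ImplicationalDoctrine P] [ExistentialDoctrine P]

open Classical in
/-- The Henkin axiom as a formula over `∏ Y_b`, for a list which contains `X̄_⋆`. -/
noncomputable def axiomAt (k : ConstList C P.Labels) (p : C × P.Labels) : P.Fiber k.ctx :=
  if h : H.starList p.1 p.2 ≤ k then P.reindex (H.inst p h) (H.psi p.1 p.2) else ⊤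

theorem axiomAt_of_le {k : ConstList C P.Labels} {p : C × P.Labels}
    (h : H.starList p.1 p.2 ≤ k) :
    H.axiomAt k p = P.reindex (H.inst p h) (H.psi p.1 p.2) := dif_pos h

theorem henkinSentence_eq {k : ConstList C P.Labels} {p : C × P.Labels}
    (h : H.starList p.1 p.2 ≤ k) :
    H.henkinSentence p = P.constMk (A := 𝟙_ (ConstCat C P.Labels)) k
      (P.reindex (fst k.ctx (𝟙_ C)) (H.axiomAt k p)) := by
  rw [axiomAt_of_le H h, reindex_reindex, ← restr_whiskerRight_starMap, ← reindex_reindex]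
  exact (P.constMk_trans (A := 𝟙_ (ConstCat C P.Labels)) h _).symm

/-- Over a common list, meets of classes are meets of representatives; this moves the problem from
the colimit to one fiber of `P`. -/
theorem inf_henkinSentence {k : ConstList C P.Labels} (U : Finset (C × P.Labels))
    (h : ∀ p ∈ U, H.starList p.1 p.2 ≤ k) :
    U.inf H.henkinSentence = P.constMk (A := 𝟙_ (ConstCat C P.Labels)) k
      (P.reindex (fst k.ctx (𝟙_ C)) (U.inf (H.axiomAt k))) := by
  classical
  induction U using Finset.induction_on with
  | empty =>
    rw [Finset.inf_empty, Finset.inf_empty, map_top]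
    refine (P.constMk_trans (A := 𝟙_ (ConstCat C P.Labels)) (nil_le k) _).symm.trans ?_
    exact congrArg _ (P.map_top _)
  | insert p U _ ih =>
    rw [Finset.inf_insert, Finset.inf_insert, map_inf,
      ih fun q hq => h q (Finset.mem_insert_of_mem hq),
      H.henkinSentence_eq (h p (Finset.mem_insert_self p U))]
    exact P.constInf_mk (A := 𝟙_ (ConstCat C P.Labels)) k _ _

/-- Finitely many Henkin axioms are not refutable. -/
theorem not_inf_axiomAt_le_bot [BoundedDoctrine P] {k : ConstList C P.Labels}
    (hk : Nontrivial (P.Fiber k.ctx)) (U : Finset (C × P.Labels))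
    (h : ∀ p ∈ U, H.starList p.1 p.2 ≤ k) :
    ¬ U.inf (H.axiomAt k) ≤ BoundedDoctrine.bot _ := by
  classical
  -- The axiom split off has maximal witness label. Ties between different sorts are harmless.
  induction U using Finset.induction_on_max_value (fun p : C × P.Labels => H.d p.1 p.2) with
  | empty =>
    intro h₀
    rw [Finset.inf_empty] at h₀
    obtain ⟨a, b, hab⟩ := hk
    have (c : P.Fiber k.ctx) : c = ⊤ :=
      top_unique (h₀.trans (BoundedDoctrine.bot_le c))
    exact hab ((this a).trans (this b).symm)
  | insert p U hp hmax ih =>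
    refine fun h₀ => ih (fun q hq => h q (Finset.mem_insert_of_mem hq)) ?_
    have hpk := h p (Finset.mem_insert_self p U)
    set c : C × P.Labels := (p.1, H.d p.1 p.2)
    -- The list `k` is kept throughout, so the constant `c` remains available as the term of sort
    -- `B` that the elimination needs.
    refine P.le_bot_of_inf_henkin_le_bot (k.proj c (hpk _ (mem_snoc _ _ (H.fresh p.1 p.2)))) _
      (P.reindex (restr ((le_snoc _ _ (H.fresh p.1 p.2)).trans hpk) ▷ p.1)
        (H.formula p.1 p.2)) ?_
    have h₁ := (P.reindex (k.replace c)).monotone h₀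
    rw [Finset.inf_insert, inf_comm, map_inf, BoundedDoctrine.reindex_bot, axiomAt_of_le H hpk,
      reindex_reindex, replace_inst_self, psi, ImplicationalDoctrine.reindex_imp,
      reindex_reindex, whiskerRight_fst, ← reindex_reindex, ← ExistentialDoctrine.beckChevalley]
      at h₁
    refine Eq.trans_le ?_ h₁
    congr 1
    rw [reindex_finset_inf, reindex_finset_inf]
    -- The other axioms do not mention `c`, so replacing it merely adds a dummy variable.
    refine Finset.inf_congr rfl fun q hq => ?_
    rw [axiomAt_of_le H (h q (Finset.mem_insert_of_mem hq)), reindex_reindex, reindex_reindex,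
      replace_inst_of_notMem]
    exact H.notMem_starList (fun e => hp (e ▸ hq)) (hmax q hq)

theorem reindex_inf_axiomAt {k m : ConstList C P.Labels} (hkm : k ≤ m)
    (U : Finset (C × P.Labels)) (h : ∀ p ∈ U, H.starList p.1 p.2 ≤ k) :
    P.reindex (restr hkm) (U.inf (H.axiomAt k)) = U.inf (H.axiomAt m) := by
  rw [reindex_finset_inf]
  refine Finset.inf_congr rfl fun p hp => ?_
  rw [axiomAt_of_le H (h p hp), reindex_reindex, restr_inst,
    axiomAt_of_le H ((h p hp).trans hkm)]

theorem henkinExtension_isConsistent [BoundedDoctrine P]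
    (hP : ∀ A : C, Nontrivial (P.Fiber A)) : H.henkinExtension.IsConsistent := by
  refine addSentences_isConsistent _ _ (P.constMk (A := 𝟙_ (ConstCat C P.Labels)) nil
    (BoundedDoctrine.bot _)) fun U hle => ?_
  obtain ⟨k, hk⟩ := H.exists_starList_le U
  rw [H.inf_henkinSentence U hk] at hle
  -- The inequality may hold only over a longer list `m`, to which the axioms are then transported.
  obtain ⟨m, hkm, hm, hle⟩ := (P.constMk_le (A := 𝟙_ (ConstCat C P.Labels))).1 hle
  have h₁ := (P.reindex (lift (𝟙 m.ctx) (toUnit m.ctx))).monotone hle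
  change P.reindex _ (P.reindex (restr hkm ▷ 𝟙_ C) _) ≤
    P.reindex _ (P.reindex (restr hm ▷ 𝟙_ C) (BoundedDoctrine.bot (nil.ctx ⊗ 𝟙_ C))) at h₁
  rw [BoundedDoctrine.reindex_bot, BoundedDoctrine.reindex_bot, reindex_reindex, reindex_reindex,
    Category.assoc, whiskerRight_fst, lift_fst_assoc, Category.id_comp,
    H.reindex_inf_axiomAt hkm U hk] at h₁
  exact H.not_inf_axiomAt_le_bot (hP _) U (fun p hp => (hk p hp).trans hkm) h₁

end HenkinChoice

end Doctrine

/-! ### Existence of choices -/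

namespace Doctrine

variable {C : Type u} [Category.{v} C] [CartesianMonoidalCategory C] {P : Doctrine.{u, v, w} C}

/-- A listing in which all labels in the `j`-th list are smaller than `j` determines choices with
`d^B_j = j`. -/
theorem nonempty_henkinChoice_of_exists
    (h : ∀ B : C, ∃ g : P.Labels → Σ l : ConstList C P.Labels, P.Fiber (l.ctx ⊗ B),
      (∀ x : (P.addConstants P.Labels).Fiber ⟨B⟩, ∃ j, x = P.constMk (g j).1 (g j).2) ∧
        ∀ j, ∀ p ∈ (g j).1.1, p.2 < j) : Nonempty P.HenkinChoice := by
  choose g hg hlt using h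
  exact ⟨{
    list := fun B j => (g B j).1
    formula := fun B j => (g B j).2
    exhaustive := hg
    d := fun _ j => j
    d_isLeast := fun B j => ⟨⟨fun _ h => h, fun k hk p hp => (hlt B k p hp).trans_le hk⟩,
      -- A bound `e < j` would have to exceed `d^B_e = e`.
      fun e he => le_of_not_gt fun hlt => lt_irrefl e (he.1 e hlt)⟩ }⟩

theorem mk_labels : Cardinal.mk P.Labels = Cardinal.mk (Σ X : C, P.Fiber X) := by simp

/-- A nonempty type which is not larger than the type of all formulas has a listing. -/
theorem exists_surjective_of_mk_le {S : Type (max u w)} [Nonempty S]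
    (h : Cardinal.mk S ≤ Cardinal.mk (Σ X : C, P.Fiber X)) :
    ∃ f : P.Labels → S, Function.Surjective f := by
  rw [← mk_labels, Cardinal.le_def] at h
  obtain ⟨e⟩ := h
  exact ⟨Function.invFun e, Function.invFun_surjective e.injective⟩

variable [PrimaryDoctrine P]

/-- Objects are encoded as formulas by `X ↦ ⊤`, so everything embeds in lists and products over the
set of all formulas, and these have its cardinality when it is infinite. -/
theorem mk_pairs_le (hinf : Cardinal.aleph0 ≤ Cardinal.mk (Σ X : C, P.Fiber X)) (B : C) :
    Cardinal.mk ((Σ l : ConstList C P.Labels, P.Fiber (l.ctx ⊗ B)) × P.Labels) ≤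
      Cardinal.mk (Σ X : C, P.Fiber X) := by
  set T := Σ X : C, P.Fiber X
  have : Infinite T := Cardinal.infinite_iff.2 hinf
  have : Infinite (T × T) := inferInstance
  obtain ⟨eL⟩ := Cardinal.eq.1 (mk_labels (P := P))
  let i : C × P.Labels → T × T := Prod.map (fun X => ⟨X, ⊤⟩) eL
  have hi : Function.Injective i :=
    Function.Injective.prodMap (fun _ _ h => congrArg Sigma.fst h) eL.injective
  let f : (Σ l : ConstList C P.Labels, P.Fiber (l.ctx ⊗ B)) × P.Labels →
      (List (T × T) × T) × T :=
    Prod.map (fun s => (s.1.1.map i, ⟨_, s.2⟩)) eL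
  have hf : Function.Injective f := by
    refine Function.Injective.prodMap ?_ eL.injective
    rintro ⟨l, φ⟩ ⟨m, ψ⟩ h
    obtain ⟨h₁, h₂⟩ := Prod.mk.inj h
    obtain rfl : l = m := Subtype.ext (List.map_injective_iff.2 hi h₁)
    exact congrArg _ (eq_of_heq (Sigma.mk.inj h₂).2)
  refine (Cardinal.mk_le_of_injective hf).trans_eq ?_
  rw [← Cardinal.mul_def, ← Cardinal.mul_def, Cardinal.mk_list_eq_mk, ← Cardinal.mul_def,
    Cardinal.mul_eq_self hinf, Cardinal.mul_eq_self hinf, Cardinal.mul_eq_self hinf]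

theorem exists_listing_of_infinite
    (hinf : Cardinal.aleph0 ≤ Cardinal.mk (Σ X : C, P.Fiber X)) (B : C) :
    ∃ g : P.Labels → Σ l : ConstList C P.Labels, P.Fiber (l.ctx ⊗ B),
      (∀ x : (P.addConstants P.Labels).Fiber ⟨B⟩, ∃ j, x = P.constMk (g j).1 (g j).2) ∧
        ∀ j, ∀ p ∈ (g j).1.1, p.2 < j := by
  classical
  set S := Σ l : ConstList C P.Labels, P.Fiber (l.ctx ⊗ B)
  have hinf' : Cardinal.aleph0 ≤ Cardinal.mk P.Labels := mk_labels (P := P) ▸ hinf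
  have : Infinite P.Labels := Cardinal.infinite_iff.2 hinf'
  have : Nonempty S := ⟨⟨nil, ⊤⟩⟩
  obtain ⟨e, he⟩ := exists_surjective_of_mk_le (mk_pairs_le hinf B)
  -- Entries that come too early for their labels are replaced by a harmless constant-free one.
  let g (j : P.Labels) : S :=
    if ∀ p ∈ (e j).1.1.1, p.2 < j then (e j).1 else ⟨nil, ⊤⟩
  refine ⟨g, fun x => ?_, fun j => ?_⟩
  · obtain ⟨l, α, rfl⟩ := P.exists_eq_constMk x
    obtain ⟨M, hM⟩ := ((l.1.map Prod.snd).toFinset).exists_le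
    obtain ⟨j, hj, hMj⟩ : ∃ j, (e j).1 = ⟨l, α⟩ ∧ M < j := by
      -- Otherwise all occurrences of `⟨l, α⟩`, one for each label `i`, would have index at most
      -- `M`; but initial segments of an initial ordinal are smaller than `Λ`.
      by_contra! hcon
      choose f hf using fun i : P.Labels => he (⟨l, α⟩, i)
      have hinj : Function.Injective fun i => (⟨f i, hcon _ (by rw [hf])⟩ : Set.Iic M) :=
        fun i i' h => by
          have := congrArg (fun z => (e z.1).2) h
          simpa [hf] using this
      refine (Cardinal.mk_le_of_injective hinj).not_gt (Cardinal.mk_Iic_lt M ?_ ?_)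
      · simp
      · exact hinf'
    have hg : g j = ⟨l, α⟩ := by
      rw [← hj]
      refine if_pos fun (p : C × P.Labels) hp => (hM p.2 ?_).trans_lt hMj
      rw [hj] at hp
      exact List.mem_toFinset.2 (List.mem_map_of_mem hp)
    exact ⟨j, by rw [hg]⟩
  · by_cases h : ∀ p ∈ (e j).1.1.1, p.2 < j
    · rw [show g j = (e j).1 from if_pos h]
      exact h
    · rw [show g j = ⟨nil, ⊤⟩ from if_neg h]
      exact fun p hp => absurd hp List.not_mem_nil

theorem exists_listing_of_finite [ExistentialDoctrine P] [Finite (Σ X : C, P.Fiber X)] (B : C) :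
    ∃ g : P.Labels → Σ l : ConstList C P.Labels, P.Fiber (l.ctx ⊗ B),
      (∀ x : (P.addConstants P.Labels).Fiber ⟨B⟩, ∃ j, x = P.constMk (g j).1 (g j).2) ∧
        ∀ j, ∀ p ∈ (g j).1.1, p.2 < j := by
  classical
  obtain ⟨eL⟩ := Cardinal.eq.1 (mk_labels (P := P))
  have : Finite P.Labels := Finite.of_equiv _ eL.symm
  have : Finite C := Finite.of_injective (fun X => (⟨X, ⊤⟩ : Σ X : C, P.Fiber X))
    fun _ _ h => congrArg Sigma.fst h
  have : Fintype (C × P.Labels) := Fintype.ofFinite _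
  -- The list of all constants contains every other list, and its product projects onto every
  -- object.
  let k : ConstList C P.Labels := ⟨Finset.univ.toList, Finset.nodup_toList _⟩
  have hk (p : C × P.Labels) : p ∈ k.1 := Finset.mem_toList.2 (Finset.mem_univ p)
  let T (φ : P.Fiber ((nil : ConstList C P.Labels).ctx ⊗ B)) : Σ X : C, P.Fiber X := ⟨_, φ⟩
  -- `P(B)`, over the empty list, is a part of the set of all formulas; a left inverse of this
  -- inclusion lists it by `Λ`.
  have hT : Function.Injective T := sigma_mk_injective
  refine ⟨fun j => ⟨nil, Function.invFun T (eL j)⟩, fun x => ?_,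
    fun j p hp => absurd hp List.not_mem_nil⟩
  obtain ⟨l, α, rfl⟩ := P.exists_eq_constMk x
  have hlk : l ≤ k := fun p _ => hk p
  obtain ⟨θ, hθ⟩ := P.exists_eq_reindex_snd_of_finite
    (fun X => ⟨k.proj (X, eL.symm ⟨X, ⊤⟩) (hk _)⟩) (P.reindex (restr hlk ▷ B) α)
  refine ⟨eL.symm (T (P.reindex (snd _ _) θ)), ?_⟩
  have hj : Function.invFun T (eL (eL.symm (T (P.reindex (snd _ _) θ)))) =
      P.reindex (snd _ _) θ := by
    rw [eL.apply_symm_apply, Function.leftInverse_invFun hT]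
  refine Eq.trans ?_ (congrArg (P.constMk (A := ⟨B⟩) nil) hj.symm)
  refine (P.constMk_trans (A := ⟨B⟩) hlk α).symm.trans ((congrArg _ ?_).trans
    (P.constMk_trans (A := ⟨B⟩) (nil_le k) _))
  rw [reindex_reindex, whiskerRight_snd]
  exact hθ

theorem nonempty_henkinChoice [ExistentialDoctrine P] : Nonempty P.HenkinChoice := by
  refine nonempty_henkinChoice_of_exists fun B => ?_
  rcases finite_or_infinite (Σ X : C, P.Fiber X) with _ | h
  · exact exists_listing_of_finite B
  · exact exists_listing_of_infinite (Cardinal.infinite_iff.1 h) B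

end Doctrine

theorem mainTheorem3 {C : Type u} [Category.{v} C] [CartesianMonoidalCategory C]
    (P : Doctrine.{u, v, w} C) [PrimaryDoctrine P] [ImplicationalDoctrine P]
    [ExistentialDoctrine P] [BoundedDoctrine P] (hP : ∀ A : C, Nontrivial (P.Fiber A)) :
    Nonempty P.HenkinChoice ∧ ∀ H : P.HenkinChoice, H.henkinExtension.IsConsistent := by
  exact ⟨Doctrine.nonempty_henkinChoice, fun H => H.henkinExtension_isConsistent hP⟩
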